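/- Let $f:\mathbb{R}^{n\times n}\to\mathbb{R}$ be twice continuously differentiable, let $r\ge 0$ be an integer, and let $m,M>0$ satisfy $M/m\le 1.15$. Assume that $f$ is $2r$-restricted $m$-strongly convex and $M$-smooth, that is, $m\mathbf{I}\preceq\nabla^2 f(X)\preceq M\mathbf{I}$ for every positive semidefinite $X\in\mathbb{R}^{n\times n}$ with $\operatorname{rank}(X)\le 2r$, where $\nabla^2 f(X)$ is the $n^2\times n^2$ Hessian matrix. Let $X^\star$ be an optimal solution of the minimization of $f$ over the cone of positive semidefinite $n\times n$ matrices, with $r^\star:=\operatorname{rank}(X^\star)\le r$, and let $g(U):=f(UU^T)$ for $U\in\mathbb{R}^{n\times r}$. Let $U\in\mathbb{R}^{n\times r}$ be a critical point of $g$, $\nabla g(U)=\mathbf{0}$, and put $r':=\operatorname{rank}(U)$ and $r'\vee r^\star:=\max\{r',r^\star\}$. Then either $X^\star=UU^T$, or $U$ is a strict saddle point of $g$, i.e. a critical point at which $\nabla^2 g(U)$ has a strictly negative eigenvalue. More precisely, if $X^\star\ne UU^T$, then for every $U^\star\in\mathbb{R}^{n\times r}$ with $X^\star=U^\star U^{\star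 T}$ and every $R$ that minimizes $\|U-U^\star R\|_F^2$ over the $r\times r$ orthogonal matrices, the direction $D=U-U^\star R$ satisfies $$[\nabla^2 g(U)](D,D)<-0.074\,m\,\bigl(\sigma_{r'\vee r^\star}(U)+\sigma_{r'\vee r^\star}(U^\star)\bigr)^2\|D\|_F^2,$$ and the smallest eigenvalue of the $nr\times nr$ Hessian matrix of $g$ at $U$ satisfies $$\lambda_{\min}(\nabla^2 g(U))<-0.074\,m\,\bigl(\sigma_{r'\vee r^\star}(U)+\sigma_{r'\vee r^\star}(U^\star)\bigr)^2 .$$ Here $\sigma_k(\cdot)$ denotes the $k$-th largest singular value. -/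

import Mathlib

open scoped Matrix

/- Every matrix space carries the Frobenius norm. -/
attribute [local instance] Matrix.frobeniusNormedAddCommGroup Matrix.frobeniusNormedSpace

namespace BurerMonteiro

noncomputable section

/-- The gradient of a scalar function of a `p × q` matrix: the matrix of its first partial
derivatives. -/
def grad {p q : ℕ} (f : Matrix (Fin p) (Fin q) ℝ → ℝ) (Z : Matrix (Fin p) (Fin q) ℝ) :
    Matrix (Fin p) (Fin q) ℝ :=
  Matrix.of fun i j => fderiv ℝ f Z (Matrix.single i j 1)

/-- The Hessian of a scalar function of a matrix as a bilinear form `[∇²f(Z)](G, H)`. -/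
def hessForm {p q : ℕ} (f : Matrix (Fin p) (Fin q) ℝ → ℝ) (Z G H : Matrix (Fin p) (Fin q) ℝ) : ℝ :=
  fderiv ℝ (fderiv ℝ f) Z G H

/-- The Hessian of a scalar function of a `p × q` matrix as a `pq × pq` matrix: its entry at
`((i, j), (k, l))` is the second partial derivative with respect to the entries `(i, j)` and
`(k, l)` of the variable. -/
def hessMatrix {p q : ℕ} (f : Matrix (Fin p) (Fin q) ℝ → ℝ) (Z : Matrix (Fin p) (Fin q) ℝ) :
    Matrix (Fin p × Fin q) (Fin p × Fin q) ℝ :=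
  Matrix.of fun a b => hessForm f Z (Matrix.single a.1 a.2 1) (Matrix.single b.1 b.2 1)

/-- `2r`-restricted `m`-strong convexity and `M`-smoothness: `m I ⪯ ∇²f(X) ⪯ M I` at every
positive semidefinite `X` of rank at most `2r`. -/
def RestrictedStrongConvexSmooth {n : ℕ} (f : Matrix (Fin n) (Fin n) ℝ → ℝ) (r : ℕ) (m M : ℝ) :
    Prop :=
  ∀ X : Matrix (Fin n) (Fin n) ℝ, X.PosSemidef → X.rank ≤ 2 * r →
    (hessMatrix f X - m • (1 : Matrix (Fin n × Fin n) (Fin n × Fin n) ℝ)).PosSemidef ∧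
    (M • (1 : Matrix (Fin n × Fin n) (Fin n × Fin n) ℝ) - hessMatrix f X).PosSemidef

/-- `X` is an optimal solution of the minimization of `f` over the positive semidefinite cone. -/
def IsOptimalPSD {n : ℕ} (f : Matrix (Fin n) (Fin n) ℝ → ℝ) (X : Matrix (Fin n) (Fin n) ℝ) :
    Prop :=
  X.PosSemidef ∧ ∀ Y : Matrix (Fin n) (Fin n) ℝ, Y.PosSemidef → f X ≤ f Y

/-- The factored objective `g(U) = f(U Uᵀ)` on `n × r` matrices. -/
def factored {n : ℕ} (f : Matrix (Fin n) (Fin n) ℝ → ℝ) (r : ℕ) (U : Matrix (Fin n) (Fin r) ℝ) :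
    ℝ :=
  f (U * Uᵀ)

/-- `l` is the smallest eigenvalue of the real square matrix `A`. -/
def IsMinEigenvalue {ι : Type} [Fintype ι] [DecidableEq ι] (A : Matrix ι ι ℝ) (l : ℝ) : Prop :=
  IsLeast {μ : ℝ | Module.End.HasEigenvalue (Matrix.toLin' A) μ} l

/-- `U` is a strict saddle point of `g`: a critical point at which the Hessian matrix has a
strictly negative eigenvalue. -/
def IsStrictSaddle {p q : ℕ} (g : Matrix (Fin p) (Fin q) ℝ → ℝ) (U : Matrix (Fin p) (Fin q) ℝ) :
    Prop :=
  grad g U = 0 ∧ ∃ μ : ℝ, μ < 0 ∧ Module.End.HasEigenvalue (Matrix.toLin' (hessMatrix g U)) μ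

/-- `R` is an orthogonal matrix that minimizes `‖U - V R‖_F²` over all orthogonal matrices. -/
def IsProcrustes {n r : ℕ} (U V : Matrix (Fin n) (Fin r) ℝ) (R : Matrix (Fin r) (Fin r) ℝ) :
    Prop :=
  R * Rᵀ = 1 ∧ ∀ S : Matrix (Fin r) (Fin r) ℝ, S * Sᵀ = 1 → ‖U - V * R‖ ^ 2 ≤ ‖U - V * S‖ ^ 2

/-- The `k`-th largest singular value of `A`, counted from `k = 1`. -/
def sigma {n r : ℕ} (k : ℕ) (A : Matrix (Fin n) (Fin r) ℝ) : ℝ :=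
  (Matrix.toEuclideanLin A).singularValues (k - 1)

end

end BurerMonteiro

open BurerMonteiro

/-! Put X = UUᵀ, V = U⋆R, D = U − V and E = X − X⋆. The Hessian of g in the direction D is
∇²f(X)(DUᵀ + UDᵀ, DUᵀ + UDᵀ) + 2⟨∇f(X), DDᵀ⟩. Criticality turns the second term into −2⟨∇f(X), E⟩,
which is at most −2m‖E‖² by strong convexity along the segment and optimality of X⋆. The first term
is at most 4M‖DUᵀ‖², so everything rests on ‖DUᵀ‖² being a small fraction of ‖E‖².

Let P be the orthogonal projection onto the range of U, and Z = EP + PE. The gradient vanishes on Z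
at X and is nonnegative on Z at X⋆, so ∇²f(E, Z) ≤ 0 at some point between. But ⟨E, Z⟩ = 2‖EP‖², and
∇²f is nearly a multiple of the identity; hence ‖EP‖² ≤ 0.0049‖E‖²
(`RestrictedStrongConvexSmooth.frobSq_mul_projection_le`). The Procrustes choice of R makes UᵀV
positive semidefinite, and then ‖DUᵀ‖² ≤ 0.22‖E‖² (`frobSq_sub_mul_transpose_le`).

The Hessian value is thus at most (4·1.15·0.22 − 2)m‖E‖² = −0.988m‖E‖². Only −0.296 is kept;
`sigma_add_sigma_sq_mul_le` trades 4‖E‖² for the singular values times ‖D‖². -/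

namespace BurerMonteiro

open Matrix

/-! ### Frobenius norm inequalities when UᵀV is positive semidefinite. -/

section FrobeniusAlgebra

variable {ι κ l : Type*} [Fintype ι] [Fintype κ] [Fintype l]

/-- The squared Frobenius norm, written as a trace. -/
noncomputable def frobSq (A : Matrix ι κ ℝ) : ℝ := (A * Aᵀ).trace

theorem frobSq_eq_sum (A : Matrix ι κ ℝ) : frobSq A = ∑ i, ∑ j, A i j ^ 2 := by
  simp [frobSq, trace, mul_apply, pow_two]

theorem norm_sq_eq_frobSq (A : Matrix ι κ ℝ) : ‖A‖ ^ 2 = frobSq A := by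
  rw [frobenius_norm_def, frobSq_eq_sum, ← Real.sqrt_eq_rpow, Real.sq_sqrt (by positivity)]
  simp

theorem frobSq_nonneg (A : Matrix ι κ ℝ) : 0 ≤ frobSq A := by
  rw [← norm_sq_eq_frobSq]; positivity

theorem frobSq_transpose (A : Matrix ι κ ℝ) : frobSq Aᵀ = frobSq A := by
  rw [frobSq, frobSq, transpose_transpose, trace_mul_comm]

theorem frobSq_neg (A : Matrix ι κ ℝ) : frobSq (-A) = frobSq A := by
  simp [frobSq]

theorem frobSq_smul (c : ℝ) (A : Matrix ι κ ℝ) : frobSq (c • A) = c ^ 2 * frobSq A := by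
  simp [frobSq, pow_two, mul_assoc]

theorem trace_mul_transpose_comm (A B : Matrix ι κ ℝ) : (A * Bᵀ).trace = (B * Aᵀ).trace := by
  rw [← trace_transpose, transpose_mul, transpose_transpose]

theorem frobSq_add (A B : Matrix ι κ ℝ) :
    frobSq (A + B) = frobSq A + frobSq B + 2 * (A * Bᵀ).trace := by
  simp only [frobSq, transpose_add, Matrix.mul_add, Matrix.add_mul, trace_add, trace_mul_transpose_comm B A]
  ring

theorem frobSq_sub (A B : Matrix ι κ ℝ) :
    frobSq (A - B) = frobSq A + frobSq B - 2 * (A * Bᵀ).trace := by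
  simp only [frobSq, transpose_sub, Matrix.mul_sub, Matrix.sub_mul, trace_sub, trace_mul_transpose_comm B A]
  ring

theorem frobSq_add_le (A B : Matrix ι κ ℝ) : frobSq (A + B) ≤ 2 * frobSq A + 2 * frobSq B := by
  have h1 := frobSq_add A B
  have h2 := frobSq_sub A B
  have h3 := frobSq_nonneg (A - B)
  linarith

theorem two_mul_trace_le (c : ℝ) (A B : Matrix ι κ ℝ) :
    2 * c * (A * Bᵀ).trace ≤ c ^ 2 * frobSq A + frobSq B := by
  have h := frobSq_nonneg (c • A - B)
  rw [frobSq_sub, frobSq_smul, smul_mul, trace_smul, smul_eq_mul] at h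
  linarith

theorem frobSq_mul_transpose (A : Matrix ι κ ℝ) (B : Matrix l κ ℝ) :
    frobSq (A * Bᵀ) = ((Aᵀ * A) * (Bᵀ * B)).trace := by
  rw [frobSq, transpose_mul, transpose_transpose, Matrix.mul_assoc Aᵀ, Matrix.trace_mul_comm Aᵀ]
  simp only [Matrix.mul_assoc]

theorem trace_mul_mul_transpose_nonneg {K : Matrix κ κ ℝ} (hK : K.PosSemidef) (D : Matrix ι κ ℝ) :
    0 ≤ ((Dᵀ * D) * K).trace := by
  have h := (hK.mul_mul_conjTranspose_same D).trace_nonneg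
  rw [conjTranspose_eq_transpose_of_trivial] at h
  rwa [Matrix.mul_assoc, Matrix.trace_mul_comm]

theorem posSemidef_gram' (A : Matrix ι κ ℝ) : (A * Aᵀ).PosSemidef := by
  simpa using posSemidef_self_mul_conjTranspose A

variable {U V : Matrix ι κ ℝ}

theorem transpose_mul_comm_of_posSemidef (hC : (Uᵀ * V).PosSemidef) : Vᵀ * U = Uᵀ * V := by
  have h := hC.isHermitian.eq
  rwa [conjTranspose_eq_transpose_of_trivial, transpose_mul, transpose_transpose] at h

theorem gram_sub (hC : (Uᵀ * V).PosSemidef) :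
    (U - V)ᵀ * (U - V) = Uᵀ * U + Vᵀ * V - (2 : ℝ) • (Uᵀ * V) := by
  rw [transpose_sub, Matrix.sub_mul, Matrix.mul_sub, Matrix.mul_sub,
    transpose_mul_comm_of_posSemidef hC, two_smul]
  abel

theorem gram_add (hC : (Uᵀ * V).PosSemidef) :
    (U + V)ᵀ * (U + V) = Uᵀ * U + Vᵀ * V + (2 : ℝ) • (Uᵀ * V) := by
  rw [transpose_add, Matrix.add_mul, Matrix.mul_add, Matrix.mul_add,
    transpose_mul_comm_of_posSemidef hC, two_smul]
  abel

theorem frobSq_gram_sub (hC : (Uᵀ * V).PosSemidef) :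
    frobSq (U * Uᵀ - V * Vᵀ) = ((Uᵀ * U) * (Uᵀ * U)).trace + ((Vᵀ * V) * (Vᵀ * V)).trace
      - 2 * ((Uᵀ * V) * (Uᵀ * V)).trace := by
  rw [frobSq_sub, frobSq_mul_transpose, frobSq_mul_transpose]
  congr 2
  rw [transpose_mul, transpose_transpose, ← Matrix.mul_assoc, Matrix.trace_mul_comm,
    Matrix.mul_assoc U, ← Matrix.mul_assoc, ← transpose_mul_comm_of_posSemidef hC]

/-- With UᵀV symmetric, everything is a trace of products of UᵀU, VᵀV and UᵀV, and the mixed traces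
on the right cancel. -/
theorem two_mul_frobSq_gram_sub (hC : (Uᵀ * V).PosSemidef) :
    2 * frobSq (U * Uᵀ - V * Vᵀ) =
      frobSq ((U - V) * (U + V)ᵀ) + frobSq (Uᵀ * U - Vᵀ * V) := by
  rw [frobSq_gram_sub hC, frobSq_mul_transpose, gram_sub hC, gram_add hC, frobSq_sub]
  simp only [frobSq, transpose_mul, transpose_transpose, Matrix.mul_add, Matrix.add_mul,
    Matrix.sub_mul, trace_add, trace_sub, Matrix.smul_mul, Matrix.mul_smul,
    trace_smul, smul_eq_mul, Matrix.trace_mul_comm (Uᵀ * V) (Uᵀ * U),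
    Matrix.trace_mul_comm (Uᵀ * V) (Vᵀ * V), Matrix.trace_mul_comm (Vᵀ * V) (Uᵀ * U)]
  ring

theorem frobSq_sub_mul_add_le (hC : (Uᵀ * V).PosSemidef) :
    frobSq ((U - V) * (U + V)ᵀ) ≤ 2 * frobSq (U * Uᵀ - V * Vᵀ) := by
  rw [two_mul_frobSq_gram_sub hC]
  linarith [frobSq_nonneg (Uᵀ * U - Vᵀ * V)]

/-- Expanding ‖(U − V)(U + V)ᵀ‖² leaves the cross term 2 tr((U − V)ᵀ(U − V)·UᵀV), nonnegative
because both factors are positive semidefinite. -/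
theorem frobSq_sub_mul_transpose_add_le (hC : (Uᵀ * V).PosSemidef) :
    frobSq ((U - V) * Uᵀ) + frobSq ((U - V) * Vᵀ) ≤ 2 * frobSq (U * Uᵀ - V * Vᵀ) := by
  refine le_trans ?_ (frobSq_sub_mul_add_le hC)
  have h := trace_mul_mul_transpose_nonneg hC (U - V)
  rw [frobSq_mul_transpose, frobSq_mul_transpose, frobSq_mul_transpose, gram_add hC, Matrix.mul_add,
    Matrix.mul_add, trace_add, trace_add, Matrix.mul_smul, trace_smul, smul_eq_mul]
  linarith

theorem frobSq_sub_gram_le (hC : (Uᵀ * V).PosSemidef) :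
    frobSq ((U - V)ᵀ * (U - V)) ≤ 2 * frobSq (U * Uᵀ - V * Vᵀ) := by
  refine le_trans ?_ (frobSq_sub_mul_add_le hC)
  have h := trace_mul_mul_transpose_nonneg hC (U - V)
  have h1 : frobSq ((U - V)ᵀ * (U - V)) = ((U - V)ᵀ * (U - V) * ((U - V)ᵀ * (U - V))).trace := by
    rw [frobSq, transpose_mul, transpose_transpose]
  have h2 : (U - V)ᵀ * (U - V) = (U + V)ᵀ * (U + V) - (4 : ℝ) • (Uᵀ * V) := by
    rw [gram_sub hC, gram_add hC]; module
  rw [frobSq_mul_transpose, h1]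
  nth_rewrite 2 [h2]
  rw [Matrix.mul_sub, trace_sub, Matrix.mul_smul, trace_smul, smul_eq_mul]
  linarith

/-- Multiplication by an orthogonal projection splits the squared Frobenius norm. -/
theorem frobSq_eq_add_of_projection [DecidableEq ι] {P : Matrix ι ι ℝ} (hPt : Pᵀ = P)
    (hPP : P * P = P) (A : Matrix ι κ ℝ) :
    frobSq A = frobSq (P * A) + frobSq ((1 - P) * A) := by
  have h : (P * A * ((1 - P) * A)ᵀ).trace = 0 := by
    rw [transpose_mul, transpose_sub, transpose_one, hPt, Matrix.trace_mul_comm]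
    rw [Matrix.mul_assoc, ← Matrix.mul_assoc (1 - P), Matrix.sub_mul, hPP]
    simp
  have h2 := frobSq_add (P * A) ((1 - P) * A)
  rw [h, ← Matrix.add_mul, add_sub_cancel, Matrix.one_mul] at h2
  linarith

theorem frobSq_projection_mul_le [DecidableEq ι] {P : Matrix ι ι ℝ} (hPt : Pᵀ = P)
    (hPP : P * P = P) (A : Matrix ι κ ℝ) : frobSq (P * A) ≤ frobSq A := by
  rw [frobSq_eq_add_of_projection hPt hPP A]
  linarith [frobSq_nonneg ((1 - P) * A)]

theorem frobSq_mul_projection_le [DecidableEq κ] {P : Matrix κ κ ℝ} (hPt : Pᵀ = P)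
    (hPP : P * P = P) (A : Matrix ι κ ℝ) : frobSq (A * P) ≤ frobSq A := by
  rw [← frobSq_transpose (A * P), transpose_mul, hPt, ← frobSq_transpose A]
  exact frobSq_projection_mul_le hPt hPP _

/-- Split (U − V)Uᵀ by P and Q = 1 − P. The P part is controlled by the pair U, PV, whose Gram
difference is PEP. The Q part is −QVUᵀ, where QV(PV)ᵀ = −QEP is small and ‖QV(U − PV)ᵀ‖² is an inner
product of two Gram matrices: one of norm at most ‖E‖, the other small. -/
theorem frobSq_sub_mul_transpose_le [DecidableEq ι] {P : Matrix ι ι ℝ} (hPt : Pᵀ = P)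
    (hPP : P * P = P) (hPU : P * U = U) (hC : (Uᵀ * V).PosSemidef)
    (hE : frobSq ((U * Uᵀ - V * Vᵀ) * P) ≤ 0.0049 * frobSq (U * Uᵀ - V * Vᵀ)) :
    frobSq ((U - V) * Uᵀ) ≤ 0.22 * frobSq (U * Uᵀ - V * Vᵀ) := by
  set E := U * Uᵀ - V * Vᵀ with hEdef
  have hQt : (1 - P)ᵀ = 1 - P := by rw [transpose_sub, transpose_one, hPt]
  have hQQ : (1 - P) * (1 - P) = 1 - P := by
    rw [Matrix.mul_sub, Matrix.sub_mul 1 P P, hPP]; simp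
  have hUP : Uᵀ * P = Uᵀ := by rw [← hPt, ← transpose_mul, hPU]
  have hQU : (1 - P) * U = 0 := by rw [Matrix.sub_mul, hPU]; simp
  obtain ⟨Q, hQ⟩ : ∃ Q, Q = 1 - P := ⟨_, rfl⟩
  rw [← hQ] at hQt hQQ hQU
  have hC' : (Uᵀ * (P * V)).PosSemidef := by rwa [← Matrix.mul_assoc, hUP]
  have hEP : U * Uᵀ - P * V * (P * V)ᵀ = P * (E * P) := by
    rw [hEdef, transpose_mul, hPt, Matrix.sub_mul, Matrix.mul_sub, Matrix.mul_assoc U, hUP,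
      ← Matrix.mul_assoc P U, hPU]
    simp only [Matrix.mul_assoc]
  have hPEP : frobSq (U * Uᵀ - P * V * (P * V)ᵀ) ≤ 0.0049 * frobSq E := by
    rw [hEP]; exact (frobSq_projection_mul_le hPt hPP _).trans hE
  have h1 := frobSq_sub_mul_transpose_add_le hC'
  have h2 := frobSq_sub_gram_le hC'
  have hsplit := frobSq_eq_add_of_projection hPt hPP ((U - V) * Uᵀ)
  rw [← hQ] at hsplit
  have e1 : P * ((U - V) * Uᵀ) = (U - P * V) * Uᵀ := by
    rw [← Matrix.mul_assoc, Matrix.mul_sub, hPU]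
  have e2 : Q * ((U - V) * Uᵀ) = -(Q * V * Uᵀ) := by
    rw [← Matrix.mul_assoc, Matrix.mul_sub, hQU, zero_sub, Matrix.neg_mul]
  have e3 : Q * V * Uᵀ = Q * V * (P * V)ᵀ + Q * V * (U - P * V)ᵀ := by
    rw [← Matrix.mul_add, ← transpose_add, add_sub_cancel]
  have e4 : Q * V * (P * V)ᵀ = -(Q * (E * P)) := by
    rw [hEdef, transpose_mul, hPt, Matrix.sub_mul, Matrix.mul_sub, Matrix.mul_assoc U,
      ← Matrix.mul_assoc _ U, hQU, Matrix.zero_mul, zero_sub, neg_neg]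
    simp only [Matrix.mul_assoc]
  have h3 : frobSq (Q * V * (P * V)ᵀ) ≤ 0.0049 * frobSq E := by
    rw [e4, frobSq_neg]; exact (frobSq_projection_mul_le hQt hQQ _).trans hE
  have h4 : frobSq ((Q * V)ᵀ * (Q * V)) ≤ frobSq E := by
    have e5 : frobSq ((Q * V)ᵀ * (Q * V)) = frobSq (Q * (E * Q)) := by
      have : Q * (E * Q) = -(Q * V * (Q * V)ᵀ) := by
        rw [hEdef, Matrix.sub_mul, Matrix.mul_sub, Matrix.mul_assoc U, ← Matrix.mul_assoc Q U,
          hQU, Matrix.zero_mul, zero_sub, transpose_mul, hQt]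
        simp only [Matrix.mul_assoc]
      rw [this, frobSq_neg, frobSq_mul_transpose, frobSq]
      simp
    rw [e5]
    exact (frobSq_projection_mul_le hQt hQQ _).trans (frobSq_mul_projection_le hQt hQQ _)
  -- The weight 0.1 ≈ √(2·0.0049) nearly balances the two terms and bounds the product by 0.099‖E‖².
  -- The total is 0.0098 + 2(0.0049 + 0.099) = 0.2176.
  have h5 := two_mul_trace_le 0.1 ((Q * V)ᵀ * (Q * V)) ((U - P * V)ᵀ * (U - P * V))
  have e6 : ((Q * V)ᵀ * (Q * V) * ((U - P * V)ᵀ * (U - P * V))ᵀ).trace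
      = frobSq (Q * V * (U - P * V)ᵀ) := by
    rw [frobSq_mul_transpose, transpose_mul (U - P * V)ᵀ, transpose_transpose]
  have h6 := frobSq_add_le (Q * V * (P * V)ᵀ) (Q * V * (U - P * V)ᵀ)
  have h7 := frobSq_nonneg ((U - P * V) * (P * V)ᵀ)
  rw [e6] at h5
  rw [hsplit, e1, e2, frobSq_neg, e3]
  linarith [frobSq_nonneg E]

theorem frobSq_symmetrize_le (A B : Matrix ι κ ℝ) :
    frobSq (A * Bᵀ + B * Aᵀ) ≤ 4 * frobSq (A * Bᵀ) := by
  have h := frobSq_add_le (A * Bᵀ) (B * Aᵀ)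
  rw [show B * Aᵀ = (A * Bᵀ)ᵀ by rw [transpose_mul, transpose_transpose], frobSq_transpose] at h
  rw [show B * Aᵀ = (A * Bᵀ)ᵀ by rw [transpose_mul, transpose_transpose]]
  linarith

end FrobeniusAlgebra

/-! ### Orthogonal Procrustes problem. -/

section Procrustes

variable {κ : Type*} [Fintype κ] [DecidableEq κ]

/-- The Householder reflection in the hyperplane orthogonal to `x`. -/
noncomputable def reflection (x : κ → ℝ) : Matrix κ κ ℝ :=
  1 - (2 / (x ⬝ᵥ x)) • vecMulVec x x

theorem reflection_transpose (x : κ → ℝ) : (reflection x)ᵀ = reflection x := by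
  simp [reflection, transpose_sub, transpose_smul, transpose_vecMulVec]

theorem reflection_mul_self {x : κ → ℝ} (hx : x ⬝ᵥ x ≠ 0) : reflection x * reflection x = 1 := by
  rw [reflection, Matrix.sub_mul, Matrix.mul_sub, Matrix.mul_sub, Matrix.one_mul, Matrix.one_mul,
    Matrix.mul_one, Matrix.smul_mul, Matrix.mul_smul, vecMulVec_mul_vecMulVec]
  simp only [smul_smul, vecMulVec_smul]
  rw [show 2 / (x ⬝ᵥ x) * (2 / (x ⬝ᵥ x) * (x ⬝ᵥ x)) = 2 / (x ⬝ᵥ x) + 2 / (x ⬝ᵥ x) by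
    field_simp; ring, add_smul]
  abel

theorem trace_vecMulVec_mul (x y : κ → ℝ) (C : Matrix κ κ ℝ) :
    (vecMulVec x y * C).trace = y ⬝ᵥ (C *ᵥ x) := by
  rw [vecMulVec_mul, trace_vecMulVec, dotProduct_comm, dotProduct_mulVec]

/-- Testing with the reflection along x gives xᵀCx ≥ 0. A product of two reflections is a small
rotation in a coordinate plane; its first-order effect on the trace must vanish, which gives
symmetry. -/
theorem posSemidef_of_trace_mul_le {C : Matrix κ κ ℝ}
    (h : ∀ S : Matrix κ κ ℝ, S * Sᵀ = 1 → (S * C).trace ≤ C.trace) : C.PosSemidef := by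
  have hpos : ∀ x : κ → ℝ, 0 ≤ x ⬝ᵥ (C *ᵥ x) := by
    intro x
    rcases eq_or_ne (x ⬝ᵥ x) 0 with hx | hx
    · rw [dotProduct_self_eq_zero] at hx
      simp [hx]
    · have hxp : 0 < x ⬝ᵥ x := lt_of_le_of_ne (by
        simpa using dotProduct_star_self_nonneg x) hx.symm
      have h1 := h (reflection x) (by rw [reflection_transpose, reflection_mul_self hx])
      rw [reflection, Matrix.sub_mul, trace_sub, Matrix.one_mul, Matrix.smul_mul, trace_smul,
        trace_vecMulVec_mul, smul_eq_mul] at h1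
      have h2 : 0 ≤ 2 / (x ⬝ᵥ x) * (x ⬝ᵥ (C *ᵥ x)) := by linarith
      exact nonneg_of_mul_nonneg_right h2 (by positivity)
  have hdiag : ∀ i, 0 ≤ C i i := by
    intro i
    simpa using hpos (Pi.single i 1)
  refine PosSemidef.of_dotProduct_mulVec_nonneg ?_ (by simpa using hpos)
  rw [IsHermitian, conjTranspose_eq_transpose_of_trivial]
  ext i j
  rw [transpose_apply]
  rcases eq_or_ne i j with rfl | hij
  · rfl
  have key : ∀ t : ℝ, t * (C j i - C i j) ≤ t ^ 2 * (C i i + C j j) := by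
    intro t
    set x : κ → ℝ := Pi.single i 1 with hx
    set y : κ → ℝ := Pi.single i 1 + t • Pi.single j 1 with hy
    have hxx : x ⬝ᵥ x = 1 := by simp [hx]
    have hxy : x ⬝ᵥ y = 1 := by simp [hx, hy, hij]
    have hyy : y ⬝ᵥ y = 1 + t ^ 2 := by
      simp [hy, hij, hij.symm, pow_two]
    have hq : 0 < 1 + t ^ 2 := by positivity
    have hort : reflection x * reflection y * (reflection x * reflection y)ᵀ = 1 := by
      rw [transpose_mul, reflection_transpose, reflection_transpose, Matrix.mul_assoc,
        ← Matrix.mul_assoc (reflection y), reflection_mul_self (by rw [hyy]; exact hq.ne'),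
        Matrix.one_mul, reflection_mul_self (by rw [hxx]; exact one_ne_zero)]
    have h1 := h _ hort
    have hCx : y ⬝ᵥ (C *ᵥ x) = C i i + t * C j i := by
      simp [hx, hy, add_dotProduct]
    have hCy : y ⬝ᵥ (C *ᵥ y) = C i i + t * C i j + t * (C j i + t * C j j) := by
      simp [hy, add_dotProduct, mulVec_add, mulVec_smul]
      ring
    have hCxx : x ⬝ᵥ (C *ᵥ x) = C i i := by simp [hx]
    rw [reflection, reflection, hxx, hyy, Matrix.sub_mul, Matrix.one_mul, Matrix.mul_sub,
      Matrix.mul_one, Matrix.smul_mul, Matrix.mul_smul, vecMulVec_mul_vecMulVec, hxy, one_smul,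
      Matrix.sub_mul, Matrix.sub_mul, Matrix.sub_mul, Matrix.one_mul, Matrix.smul_mul,
      Matrix.smul_mul, Matrix.smul_mul, Matrix.smul_mul, trace_sub, trace_sub, trace_sub,
      trace_smul, trace_smul, trace_smul, trace_smul, trace_vecMulVec_mul, trace_vecMulVec_mul,
      trace_vecMulVec_mul, hCx, hCy, hCxx] at h1
    simp only [smul_eq_mul] at h1
    have h2 : (2 / (1 + t ^ 2)) * (t * (C j i - C i j) - t ^ 2 * (C i i + C j j)) ≤ 0 := by
      refine le_trans (le_of_eq ?_) (sub_nonpos.2 h1)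
      field_simp
      ring
    have h3 := nonpos_of_mul_nonpos_right h2 (by positivity)
    linarith
  have hs : 0 ≤ C i i + C j j := add_nonneg (hdiag i) (hdiag j)
  -- With δ = C j i − C i j and s = C i i + C j j, this t gives δ²(s + 1) ≤ δ²s, so δ = 0. The added
  -- 1 keeps the denominator positive.
  have h1 := key ((C j i - C i j) / (C i i + C j j + 1))
  have h2 : (C j i - C i j) ^ 2 ≤ 0 := by
    have h3 : 0 < C i i + C j j + 1 := by linarith
    rw [div_pow, div_mul_eq_mul_div, div_mul_eq_mul_div, div_le_div_iff₀ h3 (by positivity)] at h1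
    have h4 : (C j i - C i j) ^ 2 * (C i i + C j j + 1) ≤ 0 := by
      by_contra hcon
      push Not at hcon
      nlinarith [mul_pos hcon h3]
    nlinarith [mul_nonneg (sq_nonneg (C j i - C i j)) hs]
  have h3 : C j i - C i j = 0 := by
    apply pow_eq_zero_iff (two_ne_zero) |>.1
    exact le_antisymm h2 (sq_nonneg _)
  linarith

theorem frobSq_mul_orthogonal {ι : Type*} [Fintype ι] {S : Matrix κ κ ℝ} (hS : S * Sᵀ = 1)
    (A : Matrix ι κ ℝ) : frobSq (A * S) = frobSq A := by
  rw [frobSq, transpose_mul, Matrix.mul_assoc, ← Matrix.mul_assoc S, hS, Matrix.one_mul, frobSq]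

/-- In ‖U − VRS‖² only the inner product −2 tr(S·UᵀVR) depends on S, so minimality at S = 1 is a
trace maximality. -/
theorem IsProcrustes.posSemidef {n r : ℕ} {U V : Matrix (Fin n) (Fin r) ℝ}
    {R : Matrix (Fin r) (Fin r) ℝ} (h : IsProcrustes U V R) : (Uᵀ * (V * R)).PosSemidef := by
  refine posSemidef_of_trace_mul_le fun S hS => ?_
  have hRS : R * S * (R * S)ᵀ = 1 := by
    rw [transpose_mul, Matrix.mul_assoc, ← Matrix.mul_assoc S, hS, Matrix.one_mul, h.1]
  have h1 := h.2 (R * S) hRS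
  rw [norm_sq_eq_frobSq, norm_sq_eq_frobSq, frobSq_sub, frobSq_sub, frobSq_mul_orthogonal h.1,
    frobSq_mul_orthogonal hRS, ← Matrix.mul_assoc, trace_mul_transpose_comm U,
    trace_mul_transpose_comm U, Matrix.trace_mul_comm (V * R)] at h1
  rw [← Matrix.mul_assoc S, Matrix.mul_assoc S, Matrix.trace_mul_comm S, Matrix.mul_assoc,
    Matrix.trace_mul_comm Uᵀ]
  rw [← Matrix.mul_assoc] at h1 ⊢
  linarith

theorem exists_isProcrustes {n r : ℕ} (U V : Matrix (Fin n) (Fin r) ℝ) :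
    ∃ R, IsProcrustes U V R := by
  have hcpt : IsCompact {S : Matrix (Fin r) (Fin r) ℝ | S * Sᵀ = 1} := by
    have : ProperSpace (Matrix (Fin r) (Fin r) ℝ) := FiniteDimensional.proper ℝ _
    refine Metric.isCompact_of_isClosed_isBounded ?_ ?_
    · exact isClosed_eq (by fun_prop) continuous_const
    · refine isBounded_iff_forall_norm_le.2 ⟨r + 1, fun S hS => ?_⟩
      have h1 : ‖S‖ ^ 2 = r := by
        rw [norm_sq_eq_frobSq, frobSq, hS.out]; simp
      nlinarith [norm_nonneg S]
  obtain ⟨R, hR, hmin⟩ := hcpt.exists_isMinOn ⟨1, by simp⟩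
    (f := fun S : Matrix (Fin r) (Fin r) ℝ => ‖U - V * S‖ ^ 2) (by
      apply Continuous.continuousOn
      have : Continuous fun S : Matrix (Fin r) (Fin r) ℝ => U - V * S := by fun_prop
      exact (continuous_norm.comp this).pow 2)
  exact ⟨R, hR, fun S hS => hmin hS⟩

end Procrustes

open scoped MatrixOrder

/-! ### Singular values, factorizations and smallest eigenvalues. -/

section SingularValues

theorem rank_eq_finrank_range_toEuclideanLin {n r : ℕ} (U : Matrix (Fin n) (Fin r) ℝ) :
    U.rank = Module.finrank ℝ (LinearMap.range (toEuclideanLin U)) := by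
  rw [toEuclideanLin_eq_toLin_orthonormal]
  exact U.rank_eq_finrank_range_toLin _ _

/-- The right singular vectors: an orthogonal change of columns makes the columns orthogonal, with
the singular values as lengths. -/
theorem exists_orthogonal_gram_eq_diagonal {n r : ℕ} (U : Matrix (Fin n) (Fin r) ℝ) :
    ∃ T : Matrix (Fin r) (Fin r) ℝ, T * Tᵀ = 1 ∧
      (U * T)ᵀ * (U * T) =
        diagonal fun i : Fin r => (toEuclideanLin U).singularValues i ^ 2 := by
  set L := toEuclideanLin U with hL
  have hn : Module.finrank ℝ (EuclideanSpace ℝ (Fin r)) = r := by simp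
  set b := L.isSymmetric_adjoint_comp_self.eigenvectorBasis hn with hb
  set T : Matrix (Fin r) (Fin r) ℝ := Matrix.of fun i j => b j i with hT
  have hTT : Tᵀ * T = 1 := by
    ext i j
    have h1 := orthonormal_iff_ite.1 b.orthonormal i j
    rw [EuclideanSpace.inner_eq_star_dotProduct] at h1
    rw [Matrix.one_apply, ← h1, dotProduct_comm]
    simp [mul_apply, hT, dotProduct]
  refine ⟨T, mul_eq_one_comm.1 hTT, ?_⟩
  ext i j
  have h1 : inner ℝ (L (b i)) (L (b j)) =
      ((U * T)ᵀ * (U * T)) i j := by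
    rw [EuclideanSpace.inner_eq_star_dotProduct, dotProduct_comm]
    simp only [hL, hT, mul_apply, dotProduct, transpose_apply, of_apply, star_trivial,
      ofLp_toLpLin, toLin'_apply, mulVec]
  rw [← h1, ← LinearMap.adjoint_inner_right, ← LinearMap.comp_apply,
    L.isSymmetric_adjoint_comp_self.apply_eigenvectorBasis hn j, inner_smul_right,
    orthonormal_iff_ite.1 b.orthonormal i j, diagonal_apply]
  split_ifs with h
  · subst h; simp [L.sq_singularValues_fin hn]
  · simp

theorem apply_eq_zero_of_gram_apply_self_eq_zero {ι κ : Type*} [Fintype ι] {A : Matrix ι κ ℝ}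
    {j : κ} (h : (Aᵀ * A) j j = 0) (i : ι) : A i j = 0 := by
  rw [mul_apply] at h
  simp only [transpose_apply] at h
  exact mul_self_eq_zero.1
    ((Finset.sum_eq_zero_iff_of_nonneg fun k _ => mul_self_nonneg (A k j)).1 h i (Finset.mem_univ i))

theorem singularValues_eq_zero_of_rank_le {n r k : ℕ} {U : Matrix (Fin n) (Fin r) ℝ}
    (hk : U.rank ≤ k) : (toEuclideanLin U).singularValues k = 0 := by
  rw [LinearMap.singularValues_eq_zero_iff_le_finrank_range]
  rwa [← rank_eq_finrank_range_toEuclideanLin]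

theorem sigma_nonneg {n r : ℕ} (k : ℕ) (U : Matrix (Fin n) (Fin r) ℝ) : 0 ≤ sigma k U :=
  LinearMap.singularValues_nonneg _ _

/-- A matrix of rank at most `k` has, after an orthogonal change of columns, at most `k` nonzero
columns, on which its Gram matrix is bounded below by the square of its `k`-th singular value. -/
theorem exists_orthogonal_fromCols {n k l : ℕ} (U : Matrix (Fin n) (Fin (k + l)) ℝ)
    (hU : U.rank ≤ k) :
    ∃ (T : Matrix (Fin (k + l)) (Fin (k + l)) ℝ) (A : Matrix (Fin n) (Fin k) ℝ), T * Tᵀ = 1 ∧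
      U * T = (fromCols A (0 : Matrix (Fin n) (Fin l) ℝ)).submatrix id finSumFinEquiv.symm ∧
      (Aᵀ * A - sigma k U ^ 2 • (1 : Matrix (Fin k) (Fin k) ℝ)).PosSemidef := by
  obtain ⟨T, hT, hG⟩ := exists_orthogonal_gram_eq_diagonal U
  refine ⟨T, (U * T).submatrix id (Fin.castAdd l), hT, ?_, ?_⟩
  · ext i j
    refine Fin.addCases (fun j => ?_) (fun j => ?_) j
    · simp
    · simp only [submatrix_apply, id_eq, finSumFinEquiv_symm_apply_natAdd, fromCols_apply_inr,
        Matrix.zero_apply]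
      refine apply_eq_zero_of_gram_apply_self_eq_zero ?_ i
      rw [hG, diagonal_apply_eq, singularValues_eq_zero_of_rank_le (by simp; omega)]
      simp
  · have h1 : ((U * T).submatrix id (Fin.castAdd l))ᵀ * (U * T).submatrix id (Fin.castAdd l) =
        diagonal fun i : Fin k => (toEuclideanLin U).singularValues i ^ 2 := by
      have h2 := congrArg (fun B => B.submatrix (Fin.castAdd l) (Fin.castAdd l)) hG
      rw [submatrix_mul _ _ _ id _ Function.bijective_id] at h2
      rw [transpose_submatrix, h2]
      ext i j
      simp [diagonal_apply]
    rw [h1, ← diagonal_one, ← diagonal_smul, diagonal_sub, posSemidef_diagonal_iff]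
    intro i
    simp only [Pi.smul_apply, smul_eq_mul, mul_one, sub_nonneg]
    refine pow_le_pow_left₀ (sigma_nonneg k U) ?_ 2
    -- `sigma k` has index k − 1, so i < k suffices; at k = 0, where the subtraction truncates,
    -- there is no i.
    exact LinearMap.singularValues_antitone _ (by omega)

theorem frobSq_fromCols_zero {n k l : ℕ} (A : Matrix (Fin n) (Fin k) ℝ) :
    frobSq ((fromCols A (0 : Matrix (Fin n) (Fin l) ℝ)).submatrix id finSumFinEquiv.symm) =
      frobSq A := by
  rw [frobSq_eq_sum, frobSq_eq_sum]
  simp [Fin.sum_univ_add]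

theorem fromCols_zero_mul_transpose {n k l : ℕ} (A : Matrix (Fin n) (Fin k) ℝ) :
    (fromCols A (0 : Matrix (Fin n) (Fin l) ℝ)).submatrix id finSumFinEquiv.symm *
      ((fromCols A (0 : Matrix (Fin n) (Fin l) ℝ)).submatrix id finSumFinEquiv.symm)ᵀ =
      A * Aᵀ := by
  ext i j
  simp [mul_apply, Fin.sum_univ_add]

theorem mul_transpose_self_mul_orthogonal {ι κ : Type*} [Fintype κ] [DecidableEq κ]
    {T : Matrix κ κ ℝ} (hT : T * Tᵀ = 1) (A : Matrix ι κ ℝ) : A * T * (A * T)ᵀ = A * Aᵀ := by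
  rw [transpose_mul, Matrix.mul_assoc, ← Matrix.mul_assoc T, hT, Matrix.one_mul]

theorem mul_frobSq_le_of_posSemidef_sub {ι κ l : Type*} [Fintype ι] [Fintype κ] [Fintype l]
    [DecidableEq κ] {A : Matrix l κ ℝ} {c : ℝ}
    (hA : (Aᵀ * A - c • (1 : Matrix κ κ ℝ)).PosSemidef) (D : Matrix ι κ ℝ) :
    c * frobSq D ≤ frobSq (D * Aᵀ) := by
  have h := trace_mul_mul_transpose_nonneg hA D
  rw [Matrix.mul_sub, trace_sub, Matrix.mul_smul, Matrix.mul_one, trace_smul, smul_eq_mul,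
    ← frobSq_mul_transpose, Matrix.trace_mul_comm Dᵀ D] at h
  exact sub_nonneg.1 h

/-- Rotating columns reduces U and V to blocks A and B of k columns, so that σ_k is a lower bound on
the whole block. A Procrustes solution Q for A, B, extended by the identity, competes with R, so ‖U
− VR‖ ≤ ‖A − BQ‖. -/
theorem sigma_add_sigma_sq_mul_le {n r k : ℕ} {U V : Matrix (Fin n) (Fin r) ℝ} (hk : k ≤ r)
    (hU : U.rank ≤ k) (hV : V.rank ≤ k) {R : Matrix (Fin r) (Fin r) ℝ} (hR : IsProcrustes U V R) :
    (sigma k U + sigma k V) ^ 2 * ‖U - V * R‖ ^ 2 ≤ 4 * frobSq (U * Uᵀ - V * Vᵀ) := by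
  obtain ⟨l, rfl⟩ := Nat.exists_eq_add_of_le hk
  obtain ⟨T₁, A, hT₁, hA, hAσ⟩ := exists_orthogonal_fromCols U hU
  obtain ⟨T₂, B, hT₂, hB, hBσ⟩ := exists_orthogonal_fromCols V hV
  obtain ⟨Q, hQ⟩ := exists_isProcrustes A B
  have hT₁' : T₁ᵀ * T₁ = 1 := mul_eq_one_comm.1 hT₁
  set S : Matrix (Fin (k + l)) (Fin (k + l)) ℝ :=
    (fromBlocks Q 0 0 (1 : Matrix (Fin l) (Fin l) ℝ)).submatrix finSumFinEquiv.symm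
      finSumFinEquiv.symm with hSdef
  have hS : S * Sᵀ = 1 := by
    rw [hSdef, transpose_submatrix, submatrix_mul_equiv, fromBlocks_transpose,
      fromBlocks_multiply]
    simp [hQ.1]
  have hort : T₂ * S * T₁ᵀ * (T₂ * S * T₁ᵀ)ᵀ = 1 := by
    rw [mul_transpose_self_mul_orthogonal (by rw [transpose_transpose, hT₁']),
      mul_transpose_self_mul_orthogonal hS, hT₂]
  have hVTS : V * T₂ * S =
      (fromCols (B * Q) (0 : Matrix (Fin n) (Fin l) ℝ)).submatrix id finSumFinEquiv.symm := by
    rw [hB, hSdef, submatrix_mul_equiv, fromCols_mul_fromBlocks]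
    simp
  have hD : ‖U - V * R‖ ^ 2 ≤ frobSq (A - B * Q) := by
    refine (hR.2 _ hort).trans (le_of_eq ?_)
    rw [norm_sq_eq_frobSq, ← frobSq_mul_orthogonal hT₁, Matrix.sub_mul, Matrix.mul_assoc V,
      Matrix.mul_assoc _ T₁ᵀ, hT₁', Matrix.mul_one, ← Matrix.mul_assoc, hVTS, hA,
      ← frobSq_fromCols_zero (l := l) (A - B * Q)]
    congr 1
    ext i j
    refine Fin.addCases (fun j => ?_) (fun j => ?_) j <;> simp
  have hBQσ : ((B * Q)ᵀ * (B * Q) - sigma k V ^ 2 • (1 : Matrix (Fin k) (Fin k) ℝ)).PosSemidef := by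
    have h1 := hBσ.conjTranspose_mul_mul_same Q
    rw [conjTranspose_eq_transpose_of_trivial, Matrix.mul_sub, Matrix.sub_mul, Matrix.mul_smul,
      Matrix.mul_one, Matrix.smul_mul, mul_eq_one_comm.1 hQ.1] at h1
    rw [transpose_mul]
    simpa only [Matrix.mul_assoc] using h1
  have h1 := frobSq_sub_mul_transpose_add_le hQ.posSemidef
  have h2 : A * Aᵀ = U * Uᵀ := by
    rw [← fromCols_zero_mul_transpose (l := l), ← hA, mul_transpose_self_mul_orthogonal hT₁]
  have h3 : B * Q * (B * Q)ᵀ = V * Vᵀ := by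
    rw [mul_transpose_self_mul_orthogonal hQ.1, ← fromCols_zero_mul_transpose (l := l), ← hB,
      mul_transpose_self_mul_orthogonal hT₂]
  rw [h2, h3] at h1
  have h4 := mul_frobSq_le_of_posSemidef_sub hAσ (A - B * Q)
  have h5 := mul_frobSq_le_of_posSemidef_sub hBQσ (A - B * Q)
  have h6 : (sigma k U + sigma k V) ^ 2 ≤ 2 * (sigma k U ^ 2 + sigma k V ^ 2) := by
    nlinarith [sq_nonneg (sigma k U - sigma k V)]
  calc (sigma k U + sigma k V) ^ 2 * ‖U - V * R‖ ^ 2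
      ≤ (2 * (sigma k U ^ 2 + sigma k V ^ 2)) * frobSq (A - B * Q) := by gcongr
    _ ≤ 4 * frobSq (U * Uᵀ - V * Vᵀ) := by linarith

/-- Every real matrix has a generalized inverse for which `U * K` is symmetric. -/
theorem exists_generalized_inverse {n r : ℕ} (U : Matrix (Fin n) (Fin r) ℝ) :
    ∃ K : Matrix (Fin r) (Fin n) ℝ, (U * K)ᵀ = U * K ∧ U * K * U = U := by
  obtain ⟨T, hT, hG⟩ := exists_orthogonal_gram_eq_diagonal U
  set s : Fin r → ℝ := fun i => (toEuclideanLin U).singularValues i ^ 2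
  set Y := U * T with hY
  have hU : U = Y * Tᵀ := by rw [hY, Matrix.mul_assoc, hT, Matrix.mul_one]
  have hUK : U * (T * diagonal (fun i => (s i)⁻¹) * Yᵀ) = Y * diagonal (fun i => (s i)⁻¹) * Yᵀ := by
    rw [hY]; simp only [Matrix.mul_assoc]
  refine ⟨T * diagonal (fun i => (s i)⁻¹) * Yᵀ, ?_, ?_⟩
  · rw [hUK]
    simp [transpose_mul, Matrix.mul_assoc]
  · rw [hUK]
    have h1 : Y * diagonal (fun i => (s i)⁻¹) * Yᵀ * Y = Y := by
      rw [Matrix.mul_assoc, hG, Matrix.mul_assoc, diagonal_mul_diagonal]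
      ext i j
      rw [mul_diagonal]
      -- A zero singular value belongs to a zero column of Y, so the convention 0⁻¹ = 0 is harmless.
      rcases eq_or_ne (s j) 0 with h | h
      · rw [apply_eq_zero_of_gram_apply_self_eq_zero (A := Y) (j := j) (by
          rw [hG, diagonal_apply_eq]; exact h) i, zero_mul]
      · rw [inv_mul_cancel₀ h, mul_one]
    conv_lhs => rw [hU, ← Matrix.mul_assoc, h1]
    exact hU.symm

theorem exists_eq_mul_transpose_of_rank_le {n r : ℕ} {X : Matrix (Fin n) (Fin n) ℝ}
    (hX : X.PosSemidef) (hr : X.rank ≤ r) : ∃ V : Matrix (Fin n) (Fin r) ℝ, X = V * Vᵀ := by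
  obtain ⟨B, hB : X = Bᴴ * B⟩ := CStarAlgebra.nonneg_iff_eq_star_mul_self.1 hX.nonneg
  have hrank : Bᵀ.rank ≤ r := by
    rwa [rank_transpose, ← rank_conjTranspose_mul_self, ← hB]
  obtain ⟨T, hT, hG⟩ := exists_orthogonal_gram_eq_diagonal Bᵀ
  set Y := Bᵀ * T with hY
  have hXY : X = Y * Yᵀ := by
    rw [hY, mul_transpose_self_mul_orthogonal hT, transpose_transpose, hB,
      conjTranspose_eq_transpose_of_trivial]
  have hzero : ∀ (i j : Fin n), r ≤ j → Y i j = 0 := fun i j hj =>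
    apply_eq_zero_of_gram_apply_self_eq_zero (by
      rw [hG, diagonal_apply_eq, singularValues_eq_zero_of_rank_le (hrank.trans hj)]; simp) i
  -- Columns of Y from index r on vanish and are dropped; if n < r, zero columns are added.
  refine ⟨Matrix.of fun i j => if h : (j : ℕ) < n then Y i ⟨j, h⟩ else 0, ?_⟩
  rw [hXY]
  ext i i'
  simp only [mul_apply, transpose_apply, of_apply]
  set F : ℕ → ℝ := fun j => if h : j < n then Y i ⟨j, h⟩ * Y i' ⟨j, h⟩ else 0 with hF
  have h1 : ∑ j : Fin n, Y i j * Y i' j = ∑ j ∈ Finset.range n, F j := by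
    rw [← Fin.sum_univ_eq_sum_range]
    simp [hF]
  have h2 : (∑ j : Fin r, (if h : (j : ℕ) < n then Y i ⟨j, h⟩ else 0) *
      (if h : (j : ℕ) < n then Y i' ⟨j, h⟩ else 0)) = ∑ j ∈ Finset.range r, F j := by
    rw [← Fin.sum_univ_eq_sum_range]
    refine Finset.sum_congr rfl fun j _ => ?_
    simp only [hF]
    split_ifs <;> simp
  rw [h1, h2]
  have h3 : ∑ j ∈ Finset.range n, F j = ∑ j ∈ Finset.range (max n r), F j := by
    refine Finset.sum_subset (Finset.range_mono (le_max_left _ _)) fun j _ hj => ?_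
    have : ¬ j < n := by simpa using hj
    simp [hF, this]
  have h4 : ∑ j ∈ Finset.range r, F j = ∑ j ∈ Finset.range (max n r), F j := by
    refine Finset.sum_subset (Finset.range_mono (le_max_right _ _)) fun j _ hj => ?_
    have hj : r ≤ j := by simpa using hj
    simp only [hF]
    split_ifs with h
    · rw [hzero i ⟨j, h⟩ hj, zero_mul]
    · rfl
  rw [h3, h4]

/-- A real symmetric matrix has a smallest eigenvalue, bounded by every Rayleigh quotient. -/
theorem exists_isMinEigenvalue {ι : Type} [Fintype ι] [DecidableEq ι] {A : Matrix ι ι ℝ}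
    (hA : A.IsHermitian) [Nonempty ι] :
    ∃ μ, IsMinEigenvalue A μ ∧ ∀ x : ι → ℝ, μ * (x ⬝ᵥ x) ≤ x ⬝ᵥ (A *ᵥ x) := by
  obtain ⟨i, hi⟩ := Finite.exists_min hA.eigenvalues
  have hspec : ∀ ν, Module.End.HasEigenvalue (toLin' A) ν ↔ ν ∈ Set.range hA.eigenvalues := by
    intro ν
    rw [Module.End.hasEigenvalue_iff_mem_spectrum, spectrum_toLin',
      hA.spectrum_real_eq_range_eigenvalues]
  refine ⟨hA.eigenvalues i, ⟨(hspec _).2 ⟨i, rfl⟩, ?_⟩, fun x => ?_⟩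
  · rintro ν hν
    obtain ⟨j, rfl⟩ := (hspec ν).1 hν
    exact hi j
  · have hpsd : (A - hA.eigenvalues i • (1 : Matrix ι ι ℝ)).PosSemidef := by
      rw [posSemidef_iff_isHermitian_and_spectrum_nonneg]
      refine ⟨hA.sub (isHermitian_one.smul (IsSelfAdjoint.all _)), ?_⟩
      rw [← Algebra.algebraMap_eq_smul_one, ← spectrum.sub_singleton_eq,
        hA.spectrum_real_eq_range_eigenvalues]
      rintro _ ⟨_, ⟨j, rfl⟩, _, rfl, rfl⟩
      simpa using hi j
    have h := hpsd.dotProduct_mulVec_nonneg x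
    simp only [star_trivial, sub_mulVec, smul_mulVec, one_mulVec, dotProduct_sub,
      dotProduct_smul, smul_eq_mul] at h
    linarith

end SingularValues

open Topology Filter

/-! ### Derivatives of f(B(u, u)) and first-order optimality. -/

section AbstractCalculus

variable {E F : Type*} [NormedAddCommGroup E] [NormedSpace ℝ E] [NormedAddCommGroup F]
  [NormedSpace ℝ F]

theorem differentiable_fderiv_of_contDiff_two {g : E → ℝ} (hg : ContDiff ℝ 2 g) :
    Differentiable ℝ (fderiv ℝ g) :=
  (hg.fderiv_right (m := 1) (by norm_num)).differentiable (by norm_num)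

/-- Mean value theorem for a directional derivative along a segment. -/
theorem exists_fderiv_sub_eq_fderiv_fderiv {g : E → ℝ} (hg : ContDiff ℝ 2 g) (a e z : E) :
    ∃ s ∈ Set.Ioo (0 : ℝ) 1,
      fderiv ℝ g (a + e) z - fderiv ℝ g a z = fderiv ℝ (fderiv ℝ g) (a + s • e) e z := by
  have hder : ∀ s : ℝ, HasDerivAt (fun s : ℝ => fderiv ℝ g (a + s • e) z)
      (fderiv ℝ (fderiv ℝ g) (a + s • e) e z) s := by
    intro s
    have hline : HasDerivAt (fun s : ℝ => a + s • e) e s := by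
      simpa using ((hasDerivAt_id s).smul_const e).const_add a
    have h1 := (differentiable_fderiv_of_contDiff_two hg
      (a + s • e)).hasFDerivAt.comp_hasDerivAt s hline
    simpa using h1.clm_apply (hasDerivAt_const s z)
  obtain ⟨s, hs, h⟩ := exists_hasDerivAt_eq_slope (fun s : ℝ => fderiv ℝ g (a + s • e) z)
    (fun s => fderiv ℝ (fderiv ℝ g) (a + s • e) e z) zero_lt_one
    (fun s _ => (hder s).continuousAt.continuousWithinAt) (fun s _ => hder s)
  refine ⟨s, hs, ?_⟩
  simpa using h.symm

variable (B : E →L[ℝ] E →L[ℝ] F) {f : F → ℝ}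

theorem contDiff_comp_diagonal (hf : ContDiff ℝ 2 f) : ContDiff ℝ 2 fun u => f (B u u) :=
  hf.comp (B.contDiff.clm_apply contDiff_id)

theorem hasFDerivAt_diagonal (u : E) : HasFDerivAt (fun u => B u u) (B u + B.flip u) u := by
  have h := B.hasFDerivAt_of_bilinear (hasFDerivAt_id u) (hasFDerivAt_id u)
  convert! h using 1

theorem fderiv_comp_diagonal (hf : ContDiff ℝ 2 f) (u h : E) :
    fderiv ℝ (fun u => f (B u u)) u h = fderiv ℝ f (B u u) (B u h + B h u) := by
  have h1 : HasFDerivAt (fun u => f (B u u)) _ u :=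
    HasFDerivAt.comp (f := fun u => B u u) u
      (hf.differentiable (by norm_num) (B u u)).hasFDerivAt (hasFDerivAt_diagonal B u)
  rw [h1.fderiv]
  rfl

theorem fderiv_fderiv_comp_diagonal (hf : ContDiff ℝ 2 f) (u d : E) :
    fderiv ℝ (fderiv ℝ fun u => f (B u u)) u d d =
      fderiv ℝ (fderiv ℝ f) (B u u) (B d u + B u d) (B d u + B u d) +
        2 * fderiv ℝ f (B u u) (B d d) := by
  have h1 := (differentiable_fderiv_of_contDiff_two
    (contDiff_comp_diagonal B hf) u).hasFDerivAt.clm_apply (hasFDerivAt_const d u)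
  have h2 := (HasFDerivAt.comp (f := fun u => B u u) u
    (differentiable_fderiv_of_contDiff_two hf (B u u)).hasFDerivAt
    (hasFDerivAt_diagonal B u)).clm_apply (B.flip d + B d).hasFDerivAt
  -- The first derivative in direction d pairs Df with a map linear in z, so the product rule yields
  -- exactly the two terms of the claim.
  have h3 : (fun z => fderiv ℝ (fun u => f (B u u)) z d) =
      fun z => fderiv ℝ f (B z z) ((B.flip d + B d) z) :=
    funext fun z => fderiv_comp_diagonal B hf z d
  rw [h3] at h1
  have h4 := congrArg (fun L : E →L[ℝ] ℝ => L d) (h1.unique h2)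
  simp at h4
  simp only [map_add, _root_.add_apply]
  linarith

/-- First-order optimality at a one-sided minimum along a quadratic curve. -/
theorem fderiv_nonneg_of_min_on_curve (hf : Differentiable ℝ f) {x b c : F}
    (hmin : ∀ t : ℝ, 0 ≤ t → f x ≤ f (x + t • b + t ^ 2 • c)) : 0 ≤ fderiv ℝ f x b := by
  have hγ : HasDerivAt (fun t : ℝ => x + t • b + t ^ 2 • c) b 0 := by
    have h1 := (((hasDerivAt_id (0 : ℝ)).smul_const b).const_add x).add
      (((hasDerivAt_id (0 : ℝ)).pow 2).smul_const c)
    convert! h1 using 1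
    simp
  have h1 := (hf (x + (0 : ℝ) • b + (0 : ℝ) ^ 2 • c)).hasFDerivAt.comp_hasDerivAt (0 : ℝ) hγ
  have h2 := h1.tendsto_slope_zero_right
  simp only [Function.comp, zero_smul, add_zero, zero_add, ne_eq, OfNat.ofNat_ne_zero,
    not_false_eq_true, zero_pow] at h2
  refine ge_of_tendsto h2 ?_
  filter_upwards [self_mem_nhdsWithin] with t ht
  have ht : 0 < t := ht
  exact mul_nonneg (inv_nonneg.2 ht.le) (sub_nonneg.2 (hmin t ht.le))

end AbstractCalculus

/-! ### Matrix gradients and Hessians. -/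

section Calculus

variable {p q : ℕ}

theorem map_eq_sum_single {F : Type*} [AddCommMonoid F] [Module ℝ F]
    (L : Matrix (Fin p) (Fin q) ℝ →ₗ[ℝ] F) (Z : Matrix (Fin p) (Fin q) ℝ) :
    L Z = ∑ a : Fin p × Fin q, Z a.1 a.2 • L (Matrix.single a.1 a.2 1) := by
  conv_lhs => rw [matrix_eq_sum_single Z]
  rw [Fintype.sum_prod_type, map_sum]
  refine Finset.sum_congr rfl fun i _ => ?_
  rw [map_sum]
  refine Finset.sum_congr rfl fun j _ => ?_
  rw [← map_smul, smul_single, smul_eq_mul, mul_one]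

theorem fderiv_eq_zero_of_grad_eq_zero {g : Matrix (Fin p) (Fin q) ℝ → ℝ}
    {Z : Matrix (Fin p) (Fin q) ℝ} (h : grad g Z = 0) (H : Matrix (Fin p) (Fin q) ℝ) :
    fderiv ℝ g Z H = 0 := by
  have h1 := map_eq_sum_single (fderiv ℝ g Z : Matrix (Fin p) (Fin q) ℝ →ₗ[ℝ] ℝ) H
  refine h1.trans (Finset.sum_eq_zero fun a _ => ?_)
  have h2 : fderiv ℝ g Z (Matrix.single a.1 a.2 1) = 0 := congrFun (congrFun h a.1) a.2
  simp [h2]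

theorem hessForm_eq_dotProduct (g : Matrix (Fin p) (Fin q) ℝ → ℝ)
    (Z G : Matrix (Fin p) (Fin q) ℝ) :
    hessForm g Z G G =
      (fun a : Fin p × Fin q => G a.1 a.2) ⬝ᵥ (hessMatrix g Z *ᵥ fun a => G a.1 a.2) := by
  have h1 := map_eq_sum_single
    (fderiv ℝ (fderiv ℝ g) Z : Matrix (Fin p) (Fin q) ℝ →ₗ[ℝ] Matrix (Fin p) (Fin q) ℝ →L[ℝ] ℝ) G
  have h2 : hessForm g Z G G = ∑ a : Fin p × Fin q, G a.1 a.2 *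
      fderiv ℝ (fderiv ℝ g) Z (Matrix.single a.1 a.2 1) G := by
    have h3 := congrArg (fun L : Matrix (Fin p) (Fin q) ℝ →L[ℝ] ℝ => L G) h1
    simpa [hessForm] using h3
  rw [h2, dotProduct]
  refine Finset.sum_congr rfl fun a _ => ?_
  congr 1
  have h4 := map_eq_sum_single
    (fderiv ℝ (fderiv ℝ g) Z (Matrix.single a.1 a.2 1) : Matrix (Fin p) (Fin q) ℝ →ₗ[ℝ] ℝ) G
  refine h4.trans ?_
  rw [mulVec, dotProduct]
  refine Finset.sum_congr rfl fun b _ => ?_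
  rw [smul_eq_mul, mul_comm]
  rfl

theorem dotProduct_entries_self (G : Matrix (Fin p) (Fin q) ℝ) :
    (fun a : Fin p × Fin q => G a.1 a.2) ⬝ᵥ (fun a => G a.1 a.2) = frobSq G := by
  rw [frobSq_eq_sum, dotProduct, Fintype.sum_prod_type]
  simp only [pow_two]

theorem hessForm_comm {g : Matrix (Fin p) (Fin q) ℝ → ℝ} (hg : ContDiff ℝ 2 g)
    (Z G H : Matrix (Fin p) (Fin q) ℝ) : hessForm g Z G H = hessForm g Z H G :=
  (hg.contDiffAt.isSymmSndFDerivAt (by simp)) G H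

theorem hessMatrix_isHermitian {g : Matrix (Fin p) (Fin q) ℝ → ℝ} (hg : ContDiff ℝ 2 g)
    (Z : Matrix (Fin p) (Fin q) ℝ) : (hessMatrix g Z).IsHermitian := by
  ext a b
  exact hessForm_comm hg _ _ _

variable {n r : ℕ} {f : Matrix (Fin n) (Fin n) ℝ → ℝ} {m M : ℝ}

theorem RestrictedStrongConvexSmooth.bounds (h : RestrictedStrongConvexSmooth f r m M)
    {X : Matrix (Fin n) (Fin n) ℝ} (hX : X.PosSemidef) (hr : X.rank ≤ 2 * r)
    (Z : Matrix (Fin n) (Fin n) ℝ) :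
    m * frobSq Z ≤ hessForm f X Z Z ∧ hessForm f X Z Z ≤ M * frobSq Z := by
  obtain ⟨h1, h2⟩ := h X hX hr
  have h3 := h1.dotProduct_mulVec_nonneg fun a => Z a.1 a.2
  have h4 := h2.dotProduct_mulVec_nonneg fun a => Z a.1 a.2
  simp only [star_trivial, sub_mulVec, smul_mulVec, one_mulVec, dotProduct_sub, dotProduct_smul,
    smul_eq_mul, dotProduct_entries_self, ← hessForm_eq_dotProduct] at h3 h4
  exact ⟨by linarith, by linarith⟩

theorem exists_fderiv_sub_eq_hessForm {g : Matrix (Fin p) (Fin q) ℝ → ℝ} (hg : ContDiff ℝ 2 g)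
    (A E Z : Matrix (Fin p) (Fin q) ℝ) :
    ∃ s ∈ Set.Ioo (0 : ℝ) 1,
      fderiv ℝ g (A + E) Z - fderiv ℝ g A Z = hessForm g (A + s • E) E Z :=
  exists_fderiv_sub_eq_fderiv_fderiv hg A E Z

/-- The bilinear map `(A, B) ↦ A Bᵀ`. -/
noncomputable def mulTransposeCLM (n r : ℕ) :
    Matrix (Fin n) (Fin r) ℝ →L[ℝ] Matrix (Fin n) (Fin r) ℝ →L[ℝ] Matrix (Fin n) (Fin n) ℝ :=
  (LinearMap.mk₂ ℝ (fun A B : Matrix (Fin n) (Fin r) ℝ => A * Bᵀ)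
    (fun _ _ _ => Matrix.add_mul _ _ _) (fun _ _ _ => Matrix.smul_mul _ _ _)
    (fun _ _ _ => by rw [transpose_add, Matrix.mul_add])
    (fun _ _ _ => by rw [transpose_smul, Matrix.mul_smul])).mkContinuous₂ 1 fun A B => by
      simpa [frobenius_norm_transpose] using frobenius_norm_mul A Bᵀ

theorem contDiff_factored (hf : ContDiff ℝ 2 f) : ContDiff ℝ 2 (factored f r) :=
  contDiff_comp_diagonal (mulTransposeCLM n r) hf

theorem fderiv_factored (hf : ContDiff ℝ 2 f) (U H : Matrix (Fin n) (Fin r) ℝ) :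
    fderiv ℝ (factored f r) U H = fderiv ℝ f (U * Uᵀ) (U * Hᵀ + H * Uᵀ) :=
  fderiv_comp_diagonal (mulTransposeCLM n r) hf U H

theorem hessForm_factored (hf : ContDiff ℝ 2 f) (U D : Matrix (Fin n) (Fin r) ℝ) :
    hessForm (factored f r) U D D =
      hessForm f (U * Uᵀ) (D * Uᵀ + U * Dᵀ) (D * Uᵀ + U * Dᵀ) +
        2 * fderiv ℝ f (U * Uᵀ) (D * Dᵀ) :=
  fderiv_fderiv_comp_diagonal (mulTransposeCLM n r) hf U D

theorem IsOptimalPSD.fderiv_nonneg {X B C : Matrix (Fin n) (Fin n) ℝ} (h : IsOptimalPSD f X)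
    (hf : Differentiable ℝ f)
    (hcurve : ∀ t : ℝ, 0 ≤ t → (X + t • B + t ^ 2 • C).PosSemidef) : 0 ≤ fderiv ℝ f X B :=
  fderiv_nonneg_of_min_on_curve (c := C) hf fun t ht => h.2 _ (hcurve t ht)

end Calculus

/-! ### Strong convexity and optimality at a critical point. -/

section CriticalPoints

variable {n r : ℕ} {f : Matrix (Fin n) (Fin n) ℝ → ℝ} {m M : ℝ}

theorem hessForm_smul_left (f : Matrix (Fin n) (Fin n) ℝ → ℝ) (Y : Matrix (Fin n) (Fin n) ℝ)
    (c : ℝ) (G H : Matrix (Fin n) (Fin n) ℝ) : hessForm f Y (c • G) H = c * hessForm f Y G H := by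
  simp [hessForm]

theorem hessForm_add_sub_hessForm_sub (hf : ContDiff ℝ 2 f) (Y G H : Matrix (Fin n) (Fin n) ℝ) :
    hessForm f Y (G + H) (G + H) - hessForm f Y (G - H) (G - H) = 4 * hessForm f Y G H := by
  have h := hessForm_comm hf Y G H
  have e1 : hessForm f Y (G + H) (G + H) = hessForm f Y G G + hessForm f Y G H +
      (hessForm f Y H G + hessForm f Y H H) := by
    simp [hessForm]
  have e2 : hessForm f Y (G - H) (G - H) = hessForm f Y G G - hessForm f Y G H -
      (hessForm f Y H G - hessForm f Y H H) := by
    simp [hessForm]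
  linarith

theorem posSemidef_add_smul_sub {X Y : Matrix (Fin n) (Fin n) ℝ} (hX : X.PosSemidef)
    (hY : Y.PosSemidef) {s : ℝ} (hs : s ∈ Set.Ioo (0 : ℝ) 1) :
    (Y + s • (X - Y)).PosSemidef := by
  rw [show Y + s • (X - Y) = (1 - s) • Y + s • X by module]
  exact (hY.smul (sub_nonneg.2 hs.2.le)).add (hX.smul hs.1.le)

theorem rank_add_le (A B : Matrix (Fin n) (Fin n) ℝ) : (A + B).rank ≤ A.rank + B.rank := by
  rw [Matrix.rank, mulVecLin_add]
  exact (Submodule.finrank_mono (LinearMap.range_add_le _ _)).trans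
    (Submodule.finrank_add_le_finrank_add_finrank _ _)

/-- This is where 2r enters: the restricted Hessian bounds hold along the segment between two
matrices of rank at most r. -/
theorem rank_add_smul_sub_le {X Y : Matrix (Fin n) (Fin n) ℝ} (hX : X.rank ≤ r) (hY : Y.rank ≤ r)
    (s : ℝ) : (Y + s • (X - Y)).rank ≤ 2 * r := by
  have hsmul : ∀ (c : ℝ) (A : Matrix (Fin n) (Fin n) ℝ), (c • A).rank ≤ A.rank := by
    intro c A
    rw [← Matrix.one_mul A, ← Matrix.smul_mul, Matrix.one_mul A]
    exact rank_mul_le_right _ _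
  rw [show Y + s • (X - Y) = (1 - s) • Y + s • X by module]
  have h1 := rank_add_le ((1 - s) • Y) (s • X)
  have h2 := hsmul (1 - s) Y
  have h3 := hsmul s X
  omega

/-- Restricted strong convexity forces the gradients at two positive semidefinite points apart. -/
theorem RestrictedStrongConvexSmooth.le_fderiv_sub (h : RestrictedStrongConvexSmooth f r m M)
    (hf : ContDiff ℝ 2 f) {X Y : Matrix (Fin n) (Fin n) ℝ} (hX : X.PosSemidef) (hY : Y.PosSemidef)
    (hXr : X.rank ≤ r) (hYr : Y.rank ≤ r) :
    m * frobSq (X - Y) ≤ fderiv ℝ f X (X - Y) - fderiv ℝ f Y (X - Y) := by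
  obtain ⟨s, hs, hmv⟩ := exists_fderiv_sub_eq_hessForm hf Y (X - Y) (X - Y)
  rw [add_sub_cancel] at hmv
  rw [hmv]
  exact (h.bounds (posSemidef_add_smul_sub hX hY hs) (rank_add_smul_sub_le hXr hYr s) _).1

/-- If the gradient does not increase in the direction `(X - Y) P + P (X - Y)` between `Y` and `X`,
then `(X - Y) P` is small relative to `X - Y`. -/
theorem RestrictedStrongConvexSmooth.frobSq_mul_projection_le
    (h : RestrictedStrongConvexSmooth f r m M) (hf : ContDiff ℝ 2 f) (hm : 0 < m)
    (hMm : M ≤ 1.15 * m) {X Y P : Matrix (Fin n) (Fin n) ℝ} (hX : X.PosSemidef) (hY : Y.PosSemidef)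
    (hXr : X.rank ≤ r) (hYr : Y.rank ≤ r) (hPt : Pᵀ = P) (hPP : P * P = P)
    (hle : fderiv ℝ f X ((X - Y) * P + P * (X - Y)) ≤ fderiv ℝ f Y ((X - Y) * P + P * (X - Y))) :
    frobSq ((X - Y) * P) ≤ 0.0049 * frobSq (X - Y) := by
  have hEt : (X - Y)ᵀ = X - Y := by
    have h1 := hX.isHermitian.eq
    have h2 := hY.isHermitian.eq
    rw [conjTranspose_eq_transpose_of_trivial] at h1 h2
    rw [transpose_sub, h1, h2]
  obtain ⟨s, hs, hmv⟩ := exists_fderiv_sub_eq_hessForm hf Y (X - Y) ((X - Y) * P + P * (X - Y))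
  rw [add_sub_cancel] at hmv
  set E := X - Y with hE
  set Z := E * P + P * E with hZ
  have hZE : Z = E * P + (E * P)ᵀ := by rw [hZ, transpose_mul, hPt, hEt]
  have hZle : frobSq Z ≤ 4 * frobSq (E * P) := by
    have h1 := frobSq_add_le (E * P) (E * P)ᵀ
    rw [frobSq_transpose] at h1
    rw [hZE]
    linarith
  have hEZ : (E * Zᵀ).trace = 2 * frobSq (E * P) := by
    have h1 : frobSq (E * P) = (E * (P * E)).trace := by
      rw [frobSq, transpose_mul, hPt, hEt, Matrix.mul_assoc, ← Matrix.mul_assoc P, hPP]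
    have h2 : (E * (E * P)).trace = (E * (P * E)).trace := by
      rw [Matrix.trace_mul_comm, Matrix.mul_assoc]
    have h3 : Zᵀ = Z := by
      rw [hZE, transpose_add, transpose_transpose, add_comm]
    rw [h3, hZ, Matrix.mul_add, trace_add, h2, h1]
    ring
  have hpsd := posSemidef_add_smul_sub hX hY hs
  have hrank := rank_add_smul_sub_le hXr hYr s
  rw [← hE] at hpsd hrank
  -- With p = ‖EP‖² and ‖Z‖² ≤ 4p, comparing m‖E + cZ‖² with M‖E − cZ‖² gives (8.6c − 0.6c²)p ≤
  -- 0.15‖E‖². The value 43/6 maximizes the coefficient and gives p ≤ (0.15/2.15)²‖E‖².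
  set c : ℝ := 43 / 6 with hc
  have hpol := hessForm_add_sub_hessForm_sub hf (Y + s • E) E (c • Z)
  rw [hessForm_comm hf _ E, hessForm_smul_left, hessForm_comm hf _ Z] at hpol
  have hb1 := (h.bounds hpsd hrank (E + c • Z)).1
  have hb2 := (h.bounds hpsd hrank (E - c • Z)).2
  rw [frobSq_add, frobSq_smul, transpose_smul, Matrix.mul_smul, trace_smul, smul_eq_mul,
    hEZ] at hb1
  rw [frobSq_sub, frobSq_smul, transpose_smul, Matrix.mul_smul, trace_smul, smul_eq_mul,
    hEZ] at hb2
  have hH : hessForm f (Y + s • E) E Z ≤ 0 := by rw [← hmv]; linarith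
  have he := frobSq_nonneg E
  have hp := frobSq_nonneg (E * P)
  have hz := frobSq_nonneg Z
  have hnn : 0 ≤ frobSq E + c ^ 2 * frobSq Z - 2 * (c * (2 * frobSq (E * P))) := by
    have h1 := frobSq_nonneg (E - c • Z)
    rwa [frobSq_sub, frobSq_smul, transpose_smul, Matrix.mul_smul, trace_smul, smul_eq_mul,
      hEZ] at h1
  have h1 := mul_le_mul_of_nonneg_right hMm hnn
  have h2 : m * (frobSq E + c ^ 2 * frobSq Z + 2 * (c * (2 * frobSq (E * P)))) ≤
      1.15 * m * (frobSq E + c ^ 2 * frobSq Z - 2 * (c * (2 * frobSq (E * P)))) := by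
    have h3 : c * hessForm f (Y + s • E) E Z ≤ 0 :=
      mul_nonpos_of_nonneg_of_nonpos (by norm_num [hc]) hH
    exact (hb1.trans (by linarith only [hpol, h3])).trans (hb2.trans h1)
  rw [mul_comm 1.15 m, mul_assoc] at h2
  have h3 := le_of_mul_le_mul_left h2 hm
  rw [hc] at h3
  linarith

theorem IsOptimalPSD.fderiv_sub_nonneg {X Y : Matrix (Fin n) (Fin n) ℝ} (h : IsOptimalPSD f Y)
    (hf : Differentiable ℝ f) (hX : X.PosSemidef) : 0 ≤ fderiv ℝ f Y (X - Y) := by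
  -- The quadratic term completes a square, keeping the curve in the cone for every t ≥ 0, whereas
  -- the straight segment guarantees this only for t ≤ 1.
  refine h.fderiv_nonneg (C := (1 / 4 : ℝ) • Y) hf fun t ht => ?_
  rw [show Y + t • (X - Y) + t ^ 2 • (1 / 4 : ℝ) • Y = (1 - t / 2) ^ 2 • Y + t • X by module]
  exact (h.1.smul (sq_nonneg _)).add (hX.smul ht)

/-- The direction is tangent to the curve (1 − tP)Y(1 − tP)ᵀ + 2tX, which stays in the cone. -/
theorem IsOptimalPSD.fderiv_projection_nonneg {X Y P : Matrix (Fin n) (Fin n) ℝ}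
    (h : IsOptimalPSD f Y) (hf : Differentiable ℝ f) (hX : X.PosSemidef) (hPt : Pᵀ = P)
    (hXP : X * P = X) (hPX : P * X = X) :
    0 ≤ fderiv ℝ f Y ((X - Y) * P + P * (X - Y)) := by
  refine h.fderiv_nonneg (C := P * Y * P) hf fun t ht => ?_
  have h1 : Y + t • ((X - Y) * P + P * (X - Y)) + t ^ 2 • (P * Y * P) =
      (1 - t • P) * Y * (1 - t • P)ᵀ + (2 * t) • X := by
    rw [transpose_sub, transpose_one, transpose_smul, hPt, Matrix.sub_mul X, Matrix.mul_sub P, hXP,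
      hPX, Matrix.sub_mul 1, Matrix.mul_sub, Matrix.one_mul, Matrix.mul_one, Matrix.sub_mul]
    simp only [Matrix.smul_mul, Matrix.mul_smul]
    module
  rw [h1]
  have h2 := h.1.mul_mul_conjTranspose_same (1 - t • P)
  rw [conjTranspose_eq_transpose_of_trivial] at h2
  exact h2.add (hX.smul (by positivity))

theorem hessForm_factored_lt (hf : ContDiff ℝ 2 f) (hm : 0 < m) (hMm : M ≤ 1.15 * m)
    (hRSC : RestrictedStrongConvexSmooth f r m M) {U V : Matrix (Fin n) (Fin r) ℝ}
    (hopt : IsOptimalPSD f (V * Vᵀ)) (hU : grad (factored f r) U = 0)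
    (hC : (Uᵀ * V).PosSemidef) (hne : V * Vᵀ ≠ U * Uᵀ) :
    hessForm (factored f r) U (U - V) (U - V) < -0.296 * m * frobSq (U * Uᵀ - V * Vᵀ) := by
  have hfd : Differentiable ℝ f := hf.differentiable (by norm_num)
  have hcrit : ∀ H : Matrix (Fin n) (Fin r) ℝ,
      fderiv ℝ f (U * Uᵀ) (U * Hᵀ + H * Uᵀ) = 0 := fun H => by
    rw [← fderiv_factored hf]; exact fderiv_eq_zero_of_grad_eq_zero hU H
  have hrank : ∀ A : Matrix (Fin n) (Fin r) ℝ, (A * Aᵀ).rank ≤ r := fun A =>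
    (rank_mul_le_left _ _).trans ((rank_le_card_width A).trans (by simp))
  have hX := posSemidef_gram' U
  have hY := posSemidef_gram' V
  obtain ⟨K, hKt, hKU⟩ := exists_generalized_inverse U
  set P := U * K with hP
  have hPP : P * P = P := by rw [hP, ← Matrix.mul_assoc, hKU]
  have hPX : P * (U * Uᵀ) = U * Uᵀ := by rw [← Matrix.mul_assoc, hKU]
  have hXP : U * Uᵀ * P = U * Uᵀ := by
    rw [Matrix.mul_assoc, ← hKt, ← transpose_mul, hKU]
  have hEt : (U * Uᵀ - V * Vᵀ)ᵀ = U * Uᵀ - V * Vᵀ := by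
    rw [transpose_sub, transpose_mul, transpose_mul, transpose_transpose, transpose_transpose]
  have hXZ : fderiv ℝ f (U * Uᵀ)
      ((U * Uᵀ - V * Vᵀ) * P + P * (U * Uᵀ - V * Vᵀ)) = 0 := by
    -- For H = EKᵀ, with E = UUᵀ − VVᵀ, one has UHᵀ = PE and HUᵀ = EP.
    have h1 := hcrit ((U * Uᵀ - V * Vᵀ) * Kᵀ)
    rwa [transpose_mul, transpose_transpose, hEt, Matrix.mul_assoc _ Kᵀ, ← transpose_mul, ← hP,
      hKt, ← Matrix.mul_assoc, ← hP, add_comm] at h1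
  have hEP := hRSC.frobSq_mul_projection_le hf hm hMm hX hY (hrank U) (hrank V) hKt hPP
    (by rw [hXZ]; exact hopt.fderiv_projection_nonneg hfd hX hKt hXP hPX)
  have hDU := frobSq_sub_mul_transpose_le hKt hPP hKU hC hEP
  have hmono := hRSC.le_fderiv_sub hf hX hY (hrank U) (hrank V)
  have hfirst := hopt.fderiv_sub_nonneg hfd hX
  have hDD : fderiv ℝ f (U * Uᵀ) ((U - V) * (U - V)ᵀ) =
      -fderiv ℝ f (U * Uᵀ) (U * Uᵀ - V * Vᵀ) := by
    -- The first and last brackets have the form UHᵀ + HUᵀ, for H = U and H = V, so criticality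
    -- kills them.
    have h1 : (U - V) * (U - V)ᵀ =
        (U * Uᵀ + U * Uᵀ) - (U * Uᵀ - V * Vᵀ) - (U * Vᵀ + V * Uᵀ) := by
      rw [transpose_sub, Matrix.sub_mul, Matrix.mul_sub, Matrix.mul_sub]; abel
    rw [h1, map_sub, map_sub, hcrit, hcrit]
    ring
  have hsm := (hRSC.bounds hX ((hrank U).trans (by omega))
    ((U - V) * Uᵀ + U * (U - V)ᵀ)).2
  have hsym := frobSq_symmetrize_le (U - V) U
  have hpos : 0 < frobSq (U * Uᵀ - V * Vᵀ) := by
    rw [← norm_sq_eq_frobSq]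
    have h1 : U * Uᵀ - V * Vᵀ ≠ 0 := sub_ne_zero.2 hne.symm
    have := norm_pos_iff.2 h1
    positivity
  have hK := mul_le_mul_of_nonneg_right hMm (frobSq_nonneg ((U - V) * Uᵀ + U * (U - V)ᵀ))
  have hK' : 1.15 * m * frobSq ((U - V) * Uᵀ + U * (U - V)ᵀ) ≤
      1.15 * m * (0.88 * frobSq (U * Uᵀ - V * Vᵀ)) :=
    mul_le_mul_of_nonneg_left (by linarith) (by positivity)
  rw [hessForm_factored hf, hDD]
  have := mul_pos hm hpos
  linarith

end CriticalPoints

end BurerMonteiro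

/-! ### Strict saddle theorem. -/

theorem theorem1 (n r : ℕ) (f : Matrix (Fin n) (Fin n) ℝ → ℝ) (hf : ContDiff ℝ 2 f)
    (m M : ℝ) (hm : 0 < m) (hM : 0 < M) (hMm : M / m ≤ 1.15)
    (hRSC : RestrictedStrongConvexSmooth f r m M)
    (Xstar : Matrix (Fin n) (Fin n) ℝ) (hopt : IsOptimalPSD f Xstar) (hrank : Xstar.rank ≤ r)
    (U : Matrix (Fin n) (Fin r) ℝ) (hU : grad (factored f r) U = 0) :
    Xstar = U * Uᵀ ∨
      (IsStrictSaddle (factored f r) U ∧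
        ∀ Ustar : Matrix (Fin n) (Fin r) ℝ, Xstar = Ustar * Ustarᵀ →
          (∀ R : Matrix (Fin r) (Fin r) ℝ, IsProcrustes U Ustar R →
            hessForm (factored f r) U (U - Ustar * R) (U - Ustar * R) <
              -0.074 * m *
                (sigma (max U.rank Xstar.rank) U + sigma (max U.rank Xstar.rank) Ustar) ^ 2 *
                ‖U - Ustar * R‖ ^ 2) ∧
          ∃ l : ℝ, IsMinEigenvalue (hessMatrix (factored f r) U) l ∧
            l < -0.074 * m *
              (sigma (max U.rank Xstar.rank) U + sigma (max U.rank Xstar.rank) Ustar) ^ 2) := by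
  by_cases hne : Xstar = U * Uᵀ
  · exact Or.inl hne
  right
  have hMm' : M ≤ 1.15 * m := (div_le_iff₀ hm).1 hMm
  have hdir : ∀ Ustar : Matrix (Fin n) (Fin r) ℝ, Xstar = Ustar * Ustarᵀ →
      ∀ R : Matrix (Fin r) (Fin r) ℝ, IsProcrustes U Ustar R →
        hessForm (factored f r) U (U - Ustar * R) (U - Ustar * R) <
          -0.074 * m *
            (sigma (max U.rank Xstar.rank) U + sigma (max U.rank Xstar.rank) Ustar) ^ 2 *
            ‖U - Ustar * R‖ ^ 2 := by
    intro Ustar hstar R hR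
    have hV : Ustar * R * (Ustar * R)ᵀ = Xstar := by
      rw [mul_transpose_self_mul_orthogonal hR.1, hstar]
    have h1 := hessForm_factored_lt hf hm hMm' hRSC (V := Ustar * R) (by rwa [hV]) hU
      hR.posSemidef (by rwa [hV])
    have hrk : Ustar.rank = Xstar.rank := by rw [hstar, Matrix.rank_self_mul_transpose]
    have hUr : U.rank ≤ r := (Matrix.rank_le_card_width U).trans (by simp)
    have h2 := sigma_add_sigma_sq_mul_le (max_le hUr hrank) (le_max_left U.rank Xstar.rank)
      (hrk.le.trans (le_max_right U.rank Xstar.rank)) hR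
    rw [hV] at h1
    rw [← hstar] at h2
    -- The constants match because 0.296 = 4 · 0.074.
    nlinarith [mul_le_mul_of_nonneg_left h2 hm.le]
  have heig : ∀ Ustar : Matrix (Fin n) (Fin r) ℝ, Xstar = Ustar * Ustarᵀ →
      ∃ l : ℝ, IsMinEigenvalue (hessMatrix (factored f r) U) l ∧
        l < -0.074 * m *
          (sigma (max U.rank Xstar.rank) U + sigma (max U.rank Xstar.rank) Ustar) ^ 2 := by
    intro Ustar hstar
    obtain ⟨R, hR⟩ := exists_isProcrustes U Ustar
    have hD : U - Ustar * R ≠ 0 := by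
      intro h0
      apply hne
      rw [sub_eq_zero.1 h0, mul_transpose_self_mul_orthogonal hR.1, hstar]
    -- A smallest eigenvalue exists only if nr > 0, which D ≠ 0 ensures.
    have hnonempty : Nonempty (Fin n × Fin r) := by
      by_contra hempty
      rw [not_nonempty_iff] at hempty
      exact hD (Matrix.ext fun i j => (hempty.false (i, j)).elim)
    obtain ⟨l, hl, hray⟩ := exists_isMinEigenvalue
      (hessMatrix_isHermitian (contDiff_factored (r := r) hf) U)
    refine ⟨l, hl, ?_⟩
    have h1 := hdir Ustar hstar R hR
    have h2 := hray fun a => (U - Ustar * R) a.1 a.2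
    rw [dotProduct_entries_self, ← hessForm_eq_dotProduct, ← norm_sq_eq_frobSq] at h2
    have hpos : 0 < ‖U - Ustar * R‖ ^ 2 := by
      have := norm_pos_iff.2 hD
      positivity
    exact lt_of_mul_lt_mul_right (h2.trans_lt h1) hpos.le
  refine ⟨⟨hU, ?_⟩, fun Ustar hstar => ⟨hdir Ustar hstar, heig Ustar hstar⟩⟩
  -- The strict saddle property mentions no factor of X⋆, so one has to be produced.
  obtain ⟨Ustar, hstar⟩ := exists_eq_mul_transpose_of_rank_le hopt.1 hrank
  obtain ⟨l, hl, hlt⟩ := heig Ustar hstar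
  refine ⟨l, hlt.trans_le ?_, hl.1⟩
  have : 0 ≤ 0.074 * m *
    (sigma (max U.rank Xstar.rank) U + sigma (max U.rank Xstar.rank) Ustar) ^ 2 := by positivity
  linarith
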